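/- Fix integers $K\ge 1$, $r\ge 1$ and a real $d>0$. For $n\ge K$ let $\boldsymbol{\Phi}(n,dn)$ be the random NAE-$K$-SAT formula on the variables $x_1,\dots,x_n$ with $\lfloor dn\rfloor$ independent clauses, where the $K$ variables of each clause are chosen from $x_1,\dots,x_n$ uniformly at random without replacement and each of them is negated with probability $1/2$, independently. Let $Z_{x_1},\dots,Z_{x_n}$ be i.i.d. random labels, uniform on $[0,1]$ and independent of the formula. Let $\mathbb{G}$ be the graph on $\{x_1,\dots,x_n\}$ in which two distinct variables are adjacent if they appear in the same clause. Say that $x_i$ influences $x_j$ if $x_j=x_i$ or there is a sequence of variables $y_0=x_i,y_1,\dots,y_t=x_j$ such that, for every $0\le l<t$, $y_l$ and $y_{l+1}$ are connected by a path of length at most $r$ in $\mathbb{G}$ and $Z_{y_l}>Z_{y_{l+1}}$. Let the influence range $\mathcal{IR}_{x_i}$ be the set of all variables influenced by $x_i$. Then $$\lim_{n\to\infty}\mathbb{P}\Big(\max_{1\le i\le n}|\mathcal{IR}_{x_i}|\ge n^{1/3}\Big)=0.$$ -/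

import Mathlib

open MeasureTheory ProbabilityTheory Filter
open scoped Topology

noncomputable section

/-- A (non-reduced) clause with `K` literals over the variables `x_1, …, x_n`, which are indexed
by `Fin n`: the injection `c.1` lists the `K` distinct variables of the clause, and `c.2 k` says
whether the `k`-th of them is negated. -/
abbrev NAEClause (n K : ℕ) : Type := (Fin K ↪ Fin n) × (Fin K → Bool)

/-- An instance of NAE-`K`-SAT with `n` variables and `m` clauses. -/
abbrev NAEFormula (n K m : ℕ) : Type := Fin m → NAEClause n K

instance instMeasurableSpaceFinEmbedding (n K : ℕ) : MeasurableSpace (Fin K ↪ Fin n) := ⊤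

/-- The law of a random clause: the variables are chosen uniformly at random without replacement,
and, independently, each of them is negated with probability `1/2`, independently of the others.
It is used for `K ≤ n` (for `n < K` there is no clause, and this is the zero measure). -/
def clauseLaw (n K : ℕ) : Measure (NAEClause n K) :=
  (uniformOn (Set.univ : Set (Fin K ↪ Fin n))).prod
    (Measure.pi fun _ : Fin K => uniformOn (Set.univ : Set Bool))

/-- The law of the random formula `Φ(n, dn)`: `⌊d n⌋` independent random clauses. -/
def formulaLaw (n K : ℕ) (d : ℝ) : Measure (NAEFormula n K ⌊d * n⌋₊) :=
  Measure.pi fun _ => clauseLaw n K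

/-- The law of the order labels `Z = (Z_1, …, Z_n)`: i.i.d. uniform on `[0, 1]`. -/
def labelLaw (n : ℕ) : Measure (Fin n → ℝ) :=
  Measure.pi fun _ => (volume : Measure ℝ).restrict (Set.Icc 0 1)

/-- The joint law of `(Φ(n, dn), Z)`: the formula and the labels are independent. -/
def jointLaw (n K : ℕ) (d : ℝ) : Measure (NAEFormula n K ⌊d * n⌋₊ × (Fin n → ℝ)) :=
  (formulaLaw n K d).prod (labelLaw n)

/-- The joint law is a probability measure as soon as clauses exist. -/
theorem isProbabilityMeasure_jointLaw {n K : ℕ} (h : K ≤ n) (d : ℝ) :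
    IsProbabilityMeasure (jointLaw n K d) := by
  have : Nonempty (Fin K ↪ Fin n) := ⟨Fin.castLEEmb h⟩
  have h1 : IsProbabilityMeasure (uniformOn (Set.univ : Set (Fin K ↪ Fin n))) :=
    isProbabilityMeasure_uniformOn Set.finite_univ Set.univ_nonempty
  have h2 : IsProbabilityMeasure (uniformOn (Set.univ : Set Bool)) :=
    isProbabilityMeasure_uniformOn Set.finite_univ Set.univ_nonempty
  have h3 : IsProbabilityMeasure ((volume : Measure ℝ).restrict (Set.Icc 0 1)) :=
    ⟨by simp⟩
  have h4 : IsProbabilityMeasure (clauseLaw n K) := by unfold clauseLaw; infer_instance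
  unfold jointLaw formulaLaw labelLaw
  infer_instance

/-- The variable-to-variable graph of a formula: two distinct variables are adjacent if they
appear in the same clause. -/
def varGraph {n K m : ℕ} (Φ : NAEFormula n K m) : SimpleGraph (Fin n) where
  Adj u v := u ≠ v ∧ ∃ j : Fin m, u ∈ Set.range (Φ j).1 ∧ v ∈ Set.range (Φ j).1
  symm := ⟨fun _ _ h => ⟨h.1.symm, h.2.imp fun _ hj => ⟨hj.2, hj.1⟩⟩⟩
  loopless := ⟨fun _ h => h.1 rfl⟩

/-- `u` and `v` are connected by a path of length at most `r` in `G`. -/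
def ConnectedWithin {n : ℕ} (G : SimpleGraph (Fin n)) (r : ℕ) (u v : Fin n) : Prop :=
  ∃ p : G.Walk u v, p.IsPath ∧ p.length ≤ r

/-- `x_i` influences `x_j`: either `x_j = x_i`, or there is a sequence `y_0, …, y_t` from `x_i` to
`x_j` whose consecutive members are connected by a path of length at most `r`, and along which
the labels `z` strictly decrease. -/
def Influences {n K m : ℕ} (Φ : NAEFormula n K m) (z : Fin n → ℝ) (r : ℕ) (i j : Fin n) : Prop :=
  j = i ∨ ∃ (t : ℕ) (y : Fin (t + 1) → Fin n), y 0 = i ∧ y (Fin.last t) = j ∧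
    (∀ l : Fin t, ConnectedWithin (varGraph Φ) r (y l.castSucc) (y l.succ)) ∧
    (∀ l : Fin t, z (y l.castSucc) > z (y l.succ))

/-- The influence range of `x_i`: the set of all variables influenced by `x_i`. -/
def influenceRange {n K m : ℕ} (Φ : NAEFormula n K m) (z : Fin n → ℝ) (r : ℕ) (i : Fin n) :
    Set (Fin n) :=
  {j | Influences Φ z r i j}

/-- The maximum over all variables of the size of the influence range. -/
def maxInfluence {n K m : ℕ} (Φ : NAEFormula n K m) (z : Fin n → ℝ) (r : ℕ) : ℕ :=
  Finset.univ.sup fun i : Fin n => (influenceRange Φ z r i).ncard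

end

/-! Cut `[0, 1]` into `M` slices, with `M` constant but large. Levels never rise along an influence
sequence, so it is split into stretches inside single levels. Inside a level the exploration is
subcritical. If `s` vertices of one level are reachable from `v` by steps of at most `r` edges, then
at most `r * s` clauses attached to `v` contain them. For `t` clauses, the number of clause sets, at
most `(d n) ^ t / t!`, times the number of parent maps, at most `t ^ t`, times the probability `(K²
/ n) ^ t` is at most `(e d K²) ^ t`. The labels contribute `M ^ (-s)`, and choosing the `s` vertices
costs `2 ^ (K t + 1)`. Hence the probability is of order `s (C ^ r / M) ^ s`, which is exponentially
small once `M ≥ 2 C ^ r` (`measure_large_cluster_le`). If all these clusters and all clause degrees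
are at most `s`, every influence range is bounded by a polynomial in `s` of fixed degree
(`maxInfluence_le`). Taking `s` to be a small power of `n` keeps this below `n ^ (1/3)`, while the
failure probabilities still beat the union bound over `n` vertices. -/

open scoped ENNReal

/-! ### Reachability with nonincreasing levels -/

open Relation in
/-- If all out-degrees of `H` are at most `B`, and from every vertex at most `L` vertices can be
reached inside its own level, then the level-nonincreasing reachable sets are bounded by a power
of `L * (B + 1)`. -/
theorem ncard_levelReach_le {V : Type*} [Finite V] (H : V → V → Prop) (f : V → ℕ) (L B : ℕ)
    (hB : ∀ v, {w | H v w}.ncard ≤ B)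
    (hL : ∀ v, {w | ReflTransGen (fun x y => H x y ∧ f x = f v ∧ f y = f v) v w}.ncard ≤ L)
    (a : ℕ) (v : V) (hv : f v ≤ a) :
    {w | ReflTransGen (fun x y => H x y ∧ f y ≤ f x) v w}.ncard ≤ (L * (B + 1)) ^ (a + 1) := by
  classical
  have := Fintype.ofFinite V
  induction a using Nat.strong_induction_on generalizing v with
  | _ a ih =>
  set C : Set V := {w | ReflTransGen (fun x y => H x y ∧ f x = f v ∧ f y = f v) v w} with hC
  have hL1 : 1 ≤ L := by
    refine le_trans ?_ (hL v)
    exact (Set.ncard_pos (Set.toFinite _)).2 ⟨v, ReflTransGen.refl⟩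
  set X := (L * (B + 1)) ^ a with hX
  have hX1 : 1 ≤ X := Nat.one_le_pow _ _ (by positivity)
  let R : V → Set V := fun u => {w | ReflTransGen (fun x y => H x y ∧ f y ≤ f x) u w}
  let D : V → Finset V := fun x => Finset.univ.filter fun u => H x u ∧ f u < f v
  have hsub : R v ⊆ ((C.toFinset ∪ C.toFinset.biUnion fun x => (D x).biUnion fun u =>
      (R u).toFinset : Finset V) : Set V) := by
    intro w hw
    -- A path leaves the level of `v` at most once; after its first descent, to `u`, the rest of it
    -- lies in `R u`.
    have key : w ∈ C ∨ ∃ x ∈ C, ∃ u ∈ D x, w ∈ R u := by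
      induction hw with
      | refl => exact Or.inl ReflTransGen.refl
      | @tail b c _ hbc ih' =>
        rcases ih' with hb | ⟨x, hx, u, hu, hwu⟩
        · have hfb : f b = f v := by
            rcases ReflTransGen.cases_tail hb with h | ⟨_, _, h⟩
            · rw [h]
            · exact h.2.2
          rcases (hbc.2.trans_eq hfb).lt_or_eq with h | h
          · exact Or.inr ⟨b, hb, c, by simp [D, hbc.1, h], ReflTransGen.refl⟩
          · exact Or.inl (ReflTransGen.tail hb ⟨hbc.1, hfb, h⟩)
        · exact Or.inr ⟨x, hx, u, hu, ReflTransGen.tail hwu hbc⟩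
    simpa using key
  have hCc : C.toFinset.card ≤ L := by
    rw [← Set.ncard_eq_toFinset_card']; exact hL v
  have hD : ∀ x, (D x).card ≤ B := by
    intro x
    refine le_trans ?_ (hB x)
    rw [← Set.ncard_coe_finset]
    exact Set.ncard_le_ncard (by intro u hu; simp [D] at hu; exact hu.1)
  have hR : ∀ x, ∀ u ∈ D x, (R u).toFinset.card ≤ X := by
    intro x u hu
    simp only [D, Finset.mem_filter, Finset.mem_univ, true_and] at hu
    rw [← Set.ncard_eq_toFinset_card']
    have h1 : f u + 1 ≤ a := by omega
    refine (ih (f u) (by omega) u le_rfl).trans ?_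
    exact Nat.pow_le_pow_right (by positivity) h1
  calc (R v).ncard ≤ _ := Set.ncard_le_ncard hsub
    _ ≤ L + L * (B * X) := by
        rw [Set.ncard_coe_finset]
        refine (Finset.card_union_le _ _).trans (Nat.add_le_add hCc ?_)
        refine (Finset.card_biUnion_le_card_mul _ _ (B * X) fun x _ => ?_).trans
          (Nat.mul_le_mul_right _ hCc)
        exact (Finset.card_biUnion_le_card_mul _ _ X (hR x)).trans (Nat.mul_le_mul_right _ (hD x))
    _ ≤ L * X + L * (B * X) := by gcongr; nlinarith
    _ = _ := by rw [pow_succ]; ring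

/-! ### Clause sets attached to a vertex -/

section Formula

variable {n K m : ℕ}

/-- The set of variables of the `j`-th clause. -/
def clauseVars (Φ : NAEFormula n K m) (j : Fin m) : Finset (Fin n) := Finset.univ.map (Φ j).1

/-- The variables that are equal to `v` or appear in one of the clauses from `J`. -/
def touched (Φ : NAEFormula n K m) (v : Fin n) (J : Finset (Fin m)) : Finset (Fin n) :=
  insert v (J.biUnion (clauseVars Φ))

/-- `J` can be built up clause by clause, each of them sharing a variable with `v` or with the
previous clauses. -/
inductive Attached (Φ : NAEFormula n K m) (v : Fin n) : Finset (Fin m) → Prop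
  | empty : Attached Φ v ∅
  | grow {J : Finset (Fin m)} {j : Fin m} : Attached Φ v J → j ∉ J →
      (∃ x ∈ clauseVars Φ j, x ∈ touched Φ v J) → Attached Φ v (insert j J)

/-- `J` can be built up element by element such that `π` maps each of them to itself or to a
previous one. -/
inductive IsParentMap (π : Fin m → Fin m) : Finset (Fin m) → Prop
  | empty : IsParentMap π ∅
  | grow {J : Finset (Fin m)} {j : Fin m} : IsParentMap π J → j ∉ J →
      (π j = j ∨ π j ∈ J) → IsParentMap π (insert j J)

/-- Each clause from `J` shares a variable with its parent; it contains `v` if it is its own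
parent. -/
def parentEvent (K : ℕ) (π : Fin m → Fin m) (v : Fin n) (J : Finset (Fin m)) :
    Set (NAEFormula n K m) :=
  {Φ | ∀ j ∈ J, if π j = j then v ∈ clauseVars Φ j else
    ∃ x ∈ clauseVars Φ j, x ∈ clauseVars Φ (π j)}

theorem mem_clauseVars {Φ : NAEFormula n K m} {j : Fin m} {x : Fin n} :
    x ∈ clauseVars Φ j ↔ x ∈ Set.range (Φ j).1 := by
  simp [clauseVars]

theorem card_clauseVars (Φ : NAEFormula n K m) (j : Fin m) : (clauseVars Φ j).card = K := by
  simp [clauseVars]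

theorem card_touched_le (Φ : NAEFormula n K m) (v : Fin n) (J : Finset (Fin m)) :
    (touched Φ v J).card ≤ K * J.card + 1 := by
  refine (Finset.card_insert_le _ _).trans (Nat.add_le_add_right ?_ 1)
  rw [mul_comm]
  exact Finset.card_biUnion_le_card_mul _ _ K fun j _ => (card_clauseVars Φ j).le

theorem touched_mono (Φ : NAEFormula n K m) (v : Fin n) {J J' : Finset (Fin m)} (h : J ⊆ J') :
    touched Φ v J ⊆ touched Φ v J' :=
  Finset.insert_subset_insert _ (Finset.biUnion_subset_biUnion_of_subset_left _ h)

theorem IsParentMap.mem {π : Fin m → Fin m} {J : Finset (Fin m)} (h : IsParentMap π J) :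
    ∀ j ∈ J, π j ∈ J := by
  induction h with
  | empty => simp
  | @grow J j _ _ hj ih =>
    intro i hi
    rcases Finset.mem_insert.1 hi with rfl | hi
    · rcases hj with hj | hj
      · rw [hj]; exact hi
      · exact Finset.mem_insert_of_mem hj
    · exact Finset.mem_insert_of_mem (ih i hi)

theorem IsParentMap.congr {π π' : Fin m → Fin m} {J : Finset (Fin m)} (h : IsParentMap π J)
    (hπ : ∀ j ∈ J, π' j = π j) : IsParentMap π' J := by
  induction h with
  | empty => exact .empty
  | @grow J j _ hjJ hj ih =>
    refine .grow (ih fun i hi => hπ i (Finset.mem_insert_of_mem hi)) hjJ ?_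
    rwa [hπ j (Finset.mem_insert_self _ _)]

theorem isParentMap_id (J : Finset (Fin m)) : IsParentMap id J := by
  induction J using Finset.induction_on with
  | empty => exact .empty
  | insert j J hj ih => exact .grow ih hj (Or.inl rfl)

/-- Turns attachment, whose condition involves all earlier clauses, into one condition per clause,
at the price of a union over `π`. Fixing `π` outside `J` keeps the number of maps finite in terms of
`J` alone. -/
theorem Attached.exists_parentMap {Φ : NAEFormula n K m} {v : Fin n} {J : Finset (Fin m)}
    (h : Attached Φ v J) : ∃ π : Fin m → Fin m, IsParentMap π J ∧ (∀ j, j ∉ J → π j = j) ∧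
      Φ ∈ parentEvent K π v J := by
  induction h with
  | empty => exact ⟨id, .empty, fun _ _ => rfl, by simp [parentEvent]⟩
  | @grow J j _ hjJ hj ih =>
    obtain ⟨π, hπ, hfix, hev⟩ := ih
    obtain ⟨x, hxj, hx⟩ := hj
    have key : ∃ i, (i = j ∨ i ∈ J) ∧ (if i = j then v ∈ clauseVars Φ j else
        ∃ x ∈ clauseVars Φ j, x ∈ clauseVars Φ i) := by
      rcases Finset.mem_insert.1 hx with rfl | hx
      · exact ⟨j, Or.inl rfl, by simpa using hxj⟩
      · obtain ⟨i, hi, hxi⟩ := Finset.mem_biUnion.1 hx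
        refine ⟨i, Or.inr hi, ?_⟩
        rw [if_neg (by rintro rfl; exact hjJ hi)]
        exact ⟨x, hxj, hxi⟩
    obtain ⟨i, hi, hcond⟩ := key
    have hne : ∀ l ∈ J, l ≠ j := by rintro l hl rfl; exact hjJ hl
    refine ⟨Function.update π j i, .grow (hπ.congr fun l hl => ?_) hjJ ?_, fun l hl => ?_, ?_⟩
    · simp [hne l hl]
    · simpa using hi
    · rw [Finset.mem_insert, not_or] at hl
      rw [Function.update_of_ne hl.1]
      exact hfix l hl.2
    · intro l hl
      rcases Finset.mem_insert.1 hl with rfl | hl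
      · simpa using hcond
      · rw [Function.update_of_ne (hne l hl)]
        exact hev l hl

theorem Attached.exists_walk_extension {Φ : NAEFormula n K m} {v x y : Fin n}
    (p : (varGraph Φ).Walk x y) {J : Finset (Fin m)} (h : Attached Φ v J)
    (hx : x ∈ touched Φ v J) :
    ∃ J', J ⊆ J' ∧ Attached Φ v J' ∧ J'.card ≤ J.card + p.length ∧ y ∈ touched Φ v J' := by
  induction p generalizing J with
  | nil => exact ⟨J, subset_rfl, h, le_rfl, hx⟩
  | @cons a b c hab p ih =>
    obtain ⟨j, ha, hb⟩ := hab.2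
    rw [← mem_clauseVars] at ha hb
    have hJ : Attached Φ v (insert j J) := by
      by_cases hj : j ∈ J
      · rwa [Finset.insert_eq_of_mem hj]
      · exact .grow h hj ⟨a, ha, hx⟩
    have hbt : b ∈ touched Φ v (insert j J) :=
      Finset.mem_insert_of_mem (Finset.mem_biUnion.2 ⟨j, Finset.mem_insert_self _ _, hb⟩)
    obtain ⟨J', h1, h2, h3, h4⟩ := ih hJ hbt
    refine ⟨J', (Finset.subset_insert _ _).trans h1, h2, ?_, h4⟩
    have := Finset.card_insert_le j J
    rw [SimpleGraph.Walk.length_cons]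
    omega

-- Each new vertex of `S` is joined to an old one by at most `r` edges, and each edge costs at most
-- one clause. The inner vertices of these paths are covered by `J` but not put into `S`, since
-- their levels are unconstrained.
open Relation in
theorem exists_attached_of_le_ncard {Φ : NAEFormula n K m} {v : Fin n} {r : ℕ}
    {R : Fin n → Fin n → Prop} (hR : ∀ x y, R x y → ConnectedWithin (varGraph Φ) r x y)
    (k : ℕ) (hk : k + 1 ≤ {w | ReflTransGen R v w}.ncard) :
    ∃ (S : Finset (Fin n)) (J : Finset (Fin m)), S.card = k + 1 ∧ v ∈ S ∧
      (∀ w ∈ S, ReflTransGen R v w) ∧ Attached Φ v J ∧ J.card ≤ r * k ∧ S ⊆ touched Φ v J := by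
  induction k with
  | zero =>
    refine ⟨{v}, ∅, by simp, by simp, ?_, .empty, by simp, by simp [touched]⟩
    intro w hw
    rw [Finset.mem_singleton.1 hw]
  | succ k ih =>
    obtain ⟨S, J, hS, hvS, hSR, hJ, hJc, hSJ⟩ := ih (by omega)
    obtain ⟨w, hw, hwS⟩ : ∃ w, ReflTransGen R v w ∧ w ∉ S := by
      by_contra! hcon
      have h1 : {w | ReflTransGen R v w} ⊆ (S : Set (Fin n)) := fun w hw => hcon w hw
      have := Set.ncard_le_ncard h1
      rw [Set.ncard_coe_finset] at this
      omega
    obtain ⟨x, y, hx, hy, hxy⟩ : ∃ x y, x ∈ S ∧ y ∉ S ∧ R x y := by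
      induction hw with
      | refl => exact absurd hvS hwS
      | @tail b c _ hbc ih' =>
        by_cases hb : b ∈ S
        · exact ⟨b, c, hb, hwS, hbc⟩
        · exact ih' hb
    obtain ⟨p, _, hp⟩ := hR x y hxy
    obtain ⟨J', h1, h2, h3, h4⟩ := hJ.exists_walk_extension p (hSJ hx)
    refine ⟨insert y S, J', by simp [hy, hS], Finset.mem_insert_of_mem hvS, ?_, h2, ?_, ?_⟩
    · intro w hw
      rcases Finset.mem_insert.1 hw with rfl | hw
      · exact (hSR x hx).tail hxy
      · exact hSR w hw
    · rw [Nat.mul_succ]; omega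
    · exact Finset.insert_subset h4 (hSJ.trans (touched_mono Φ v h1))

/-! ### Deterministic bound on the influence ranges -/

theorem ncard_connectedWithin_le (G : SimpleGraph (Fin n)) (Δ : ℕ)
    (hΔ : ∀ v, {w | G.Adj v w}.ncard ≤ Δ) (r : ℕ) (v : Fin n) :
    {w | ConnectedWithin G r v w}.ncard ≤ (Δ + 1) ^ r := by
  classical
  have key : ∀ (r : ℕ) (v : Fin n), {w | ∃ p : G.Walk v w, p.length ≤ r}.ncard ≤ (Δ + 1) ^ r := by
    intro r
    induction r with
    | zero =>
      intro v
      refine (Set.ncard_le_ncard (t := {v}) ?_).trans (by simp)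
      rintro w ⟨p, hp⟩
      exact (SimpleGraph.Walk.eq_of_length_eq_zero (Nat.le_zero.1 hp)).symm
    | succ r ih =>
      intro v
      let W : Fin n → Set (Fin n) := fun u => {w | ∃ p : G.Walk u w, p.length ≤ r}
      have hsub : {w | ∃ p : G.Walk v w, p.length ≤ r + 1} ⊆
          ((insert v {w | G.Adj v w}.toFinset).biUnion fun u => (W u).toFinset :
            Finset (Fin n)) := by
        rintro w ⟨p, hp⟩
        simp only [Finset.coe_biUnion, Set.mem_iUnion, Finset.mem_coe, Set.mem_toFinset]
        cases p with
        | nil => exact ⟨v, Finset.mem_insert_self _ _, .nil, by simp⟩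
        | @cons _ u _ h q =>
          exact ⟨u, by simp [h], q, by simpa using hp⟩
      refine (Set.ncard_le_ncard hsub).trans ?_
      rw [Set.ncard_coe_finset, pow_succ, mul_comm]
      refine (Finset.card_biUnion_le_card_mul _ _ ((Δ + 1) ^ r) fun u _ => ?_).trans ?_
      · rw [← Set.ncard_eq_toFinset_card']; exact ih u
      · refine Nat.mul_le_mul_right _ ((Finset.card_insert_le _ _).trans ?_)
        rw [← Set.ncard_eq_toFinset_card']
        exact Nat.add_le_add_right (hΔ v) 1
  refine (Set.ncard_le_ncard ?_).trans (key r v)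
  rintro w ⟨p, _, hp⟩
  exact ⟨p, hp⟩

theorem ncard_adj_le (Φ : NAEFormula n K m) (v : Fin n) (s : ℕ)
    (h : (Finset.univ.filter fun j => v ∈ clauseVars Φ j).card ≤ s) :
    {w | (varGraph Φ).Adj v w}.ncard ≤ s * K := by
  have hsub : {w | (varGraph Φ).Adj v w} ⊆
      ((Finset.univ.filter fun j => v ∈ clauseVars Φ j).biUnion (clauseVars Φ) :
        Finset (Fin n)) := by
    rintro w ⟨_, j, hv, hw⟩
    rw [← mem_clauseVars] at hv hw
    simp only [Finset.coe_biUnion, Set.mem_iUnion, Finset.mem_coe]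
    exact ⟨j, by simpa using hv, hw⟩
  refine (Set.ncard_le_ncard hsub).trans ?_
  rw [Set.ncard_coe_finset]
  exact (Finset.card_biUnion_le_card_mul _ _ K fun j _ => (card_clauseVars Φ j).le).trans
    (Nat.mul_le_mul_right _ h)

/-- The index of the slice of `[0, 1]`, cut into `M` pieces, that contains the label. -/
noncomputable def level (M : ℕ) (z : Fin n → ℝ) (x : Fin n) : ℕ := min ⌊M * z x⌋₊ M

open Relation in
theorem influenceRange_subset (Φ : NAEFormula n K m) (z : Fin n → ℝ) (r M : ℕ) (i : Fin n) :
    influenceRange Φ z r i ⊆ {w | ReflTransGen (fun x y =>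
      ConnectedWithin (varGraph Φ) r x y ∧ level M z y ≤ level M z x) i w} := by
  rintro j (rfl | ⟨t, y, rfl, rfl, hc, hz⟩)
  · exact ReflTransGen.refl
  · have : ∀ l : Fin (t + 1), ReflTransGen (fun x y =>
        ConnectedWithin (varGraph Φ) r x y ∧ level M z y ≤ level M z x) (y 0) (y l) := by
      intro l
      induction l using Fin.induction with
      | zero => exact ReflTransGen.refl
      | succ l ih =>
        refine ih.tail ⟨hc l, min_le_min_right _ (Nat.floor_le_floor ?_)⟩
        exact mul_le_mul_of_nonneg_left (hz l).le (Nat.cast_nonneg _)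
    exact this _

open Relation in
/-- Small degrees and small clusters inside the levels bound all the influence ranges. -/
theorem maxInfluence_le (Φ : NAEFormula n K m) (z : Fin n → ℝ) (r M s : ℕ)
    (hdeg : ∀ v, (Finset.univ.filter fun j => v ∈ clauseVars Φ j).card ≤ s)
    (hcl : ∀ v, {w | ReflTransGen (fun x y => ConnectedWithin (varGraph Φ) r x y ∧
      level M z x = level M z v ∧ level M z y = level M z v) v w}.ncard ≤ s) :
    maxInfluence Φ z r ≤ (s * ((s * K + 1) ^ r + 1)) ^ (M + 1) := by
  refine Finset.sup_le fun i _ => ?_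
  refine (Set.ncard_le_ncard (influenceRange_subset Φ z r M i)).trans ?_
  exact ncard_levelReach_le _ (level M z) s _
    (ncard_connectedWithin_le _ _ (fun v => ncard_adj_le Φ v s (hdeg v)) r) hcl M i
    (min_le_right _ _)

end Formula

/-! ### Estimates for random clauses and labels -/

/-- If all sections over `E` have measure at most `c`, and the other ones are empty, then the set
has measure at most `μ E * c`. -/
theorem prod_le_mul_of_section_le {α β : Type*} [Fintype α] [MeasurableSpace α]
    [MeasurableSingletonClass α] [MeasurableSpace β] (μ : Measure α) (ν : Measure β)
    [SFinite ν] (E : Set α) (T : Set (α × β)) (c : ℝ≥0∞)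
    (hE : ∀ x ∈ T, x.1 ∈ E) (hc : ∀ a ∈ E, ν {b | (a, b) ∈ T} ≤ c) :
    (μ.prod ν) T ≤ μ E * c := by
  classical
  -- As `α` is finite, finitely many slices cover `T`, so `T` need not be measurable.
  have hsub : T ⊆ ⋃ a ∈ E.toFinset, {a} ×ˢ {b | (a, b) ∈ T} := by
    rintro ⟨a, b⟩ h
    simp only [Set.mem_iUnion, Set.mem_toFinset]
    exact ⟨a, hE _ h, rfl, h⟩
  calc (μ.prod ν) T ≤ ∑ a ∈ E.toFinset, (μ.prod ν) ({a} ×ˢ {b | (a, b) ∈ T}) :=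
        (measure_mono hsub).trans (measure_biUnion_finset_le _ _)
    _ ≤ ∑ a ∈ E.toFinset, μ {a} * c := by
        refine Finset.sum_le_sum fun a ha => ?_
        refine (Measure.prod_prod_le _ _).trans ?_
        gcongr
        exact hc a (Set.mem_toFinset.1 ha)
    _ = μ E * c := by
        rw [← Finset.sum_mul, sum_measure_singleton, Set.coe_toFinset]

section Formula

variable {n K m : ℕ}

theorem uniformOn_embedding_apply_eq_le (p : Fin K) (x : Fin n) :
    uniformOn (Set.univ : Set (Fin K ↪ Fin n)) {e | e p = x} ≤ 1 / (n : ℝ≥0∞) := by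
  classical
  let N : Fin n → ℕ := fun y => (Finset.univ.filter fun e : Fin K ↪ Fin n => e p = y).card
  -- Swapping `x` and `y` in the target shows that all `n` fibres of `e ↦ e p` have the same size.
  have hN : ∀ y, N y = N x := by
    intro y
    refine Finset.card_bij (fun e _ => e.trans (Equiv.swap x y).toEmbedding) ?_ ?_ ?_
    · intro e he
      simp only [Finset.mem_filter, Finset.mem_univ, true_and] at he ⊢
      simp [he]
    · intro e _ e' _ h
      ext i
      have := DFunLike.congr_fun h i
      simpa using congrArg Fin.val ((Equiv.swap x y).injective this)
    · intro e he
      simp only [Finset.mem_filter, Finset.mem_univ, true_and] at he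
      refine ⟨e.trans (Equiv.swap x y).toEmbedding, by simp [he], ?_⟩
      ext i
      simp
  have hsum : Fintype.card (Fin K ↪ Fin n) = n * N x := by
    rw [← Finset.card_univ, Finset.card_eq_sum_card_fiberwise (f := fun e => e p)
      (t := Finset.univ) (by simp)]
    rw [Finset.sum_congr rfl fun y _ => hN y]
    simp
  have : MeasurableSingletonClass (Fin K ↪ Fin n) := ⟨fun _ => trivial⟩
  have hn : (n : ℝ≥0∞) ≠ 0 := by
    have := x.pos
    exact_mod_cast this.ne'
  have hset : {e : Fin K ↪ Fin n | e p = x} =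
      ((Finset.univ.filter fun e : Fin K ↪ Fin n => e p = x : Finset _) : Set _) := by
    ext; simp
  rw [uniformOn_univ, hset, Measure.count_apply_finset, hsum]
  refine ENNReal.div_le_of_le_mul ?_
  rw [Nat.cast_mul, ← mul_assoc, one_div, ENNReal.inv_mul_cancel hn (ENNReal.natCast_ne_top n),
    one_mul]

theorem isProbabilityMeasure_clauseLaw (h : K ≤ n) : IsProbabilityMeasure (clauseLaw n K) := by
  have : Nonempty (Fin K ↪ Fin n) := ⟨Fin.castLEEmb h⟩
  have : MeasurableSingletonClass (Fin K ↪ Fin n) := ⟨fun _ => trivial⟩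
  have h1 : IsProbabilityMeasure (uniformOn (Set.univ : Set (Fin K ↪ Fin n))) :=
    isProbabilityMeasure_uniformOn Set.finite_univ Set.univ_nonempty
  have h2 : IsProbabilityMeasure (uniformOn (Set.univ : Set Bool)) :=
    isProbabilityMeasure_uniformOn Set.finite_univ Set.univ_nonempty
  unfold clauseLaw
  infer_instance

theorem clauseLaw_hits_le (S : Finset (Fin n)) :
    clauseLaw n K {c | ∃ x ∈ Set.range c.1, x ∈ S} ≤ (S.card * K : ℕ) / (n : ℝ≥0∞) := by
  have h2 : IsProbabilityMeasure (uniformOn (Set.univ : Set Bool)) :=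
    isProbabilityMeasure_uniformOn Set.finite_univ Set.univ_nonempty
  have hsub : {c : NAEClause n K | ∃ x ∈ Set.range c.1, x ∈ S} ⊆
      ⋃ q ∈ S ×ˢ (Finset.univ : Finset (Fin K)), {e : Fin K ↪ Fin n | e q.2 = q.1} ×ˢ Set.univ := by
    rintro c ⟨x, ⟨p, rfl⟩, hx⟩
    simp only [Set.mem_iUnion]
    exact ⟨(c.1 p, p), by simpa using hx, by simp⟩
  refine (measure_mono hsub).trans ((measure_biUnion_finset_le _ _).trans ?_)
  calc _ ≤ ∑ q ∈ S ×ˢ (Finset.univ : Finset (Fin K)), 1 / (n : ℝ≥0∞) := by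
        refine Finset.sum_le_sum fun q _ => ?_
        refine (Measure.prod_prod_le _ _).trans ?_
        rw [measure_univ, mul_one]
        exact uniformOn_embedding_apply_eq_le q.2 q.1
    _ = _ := by simp [div_eq_mul_inv]

/-- Integrate out the coordinate `j` first: `A` does not depend on it, and `B` has conditional
probability at most `c`. -/
theorem pi_le_mul_of_fiber_le {ι Ω : Type*} [Fintype ι] [DecidableEq ι] [Fintype Ω]
    [MeasurableSpace Ω] [MeasurableSingletonClass Ω] (μ : Measure Ω) [IsProbabilityMeasure μ]
    (j : ι) (A B : Set (ι → Ω)) (c : ℝ≥0∞)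
    (hA : ∀ x ω, Function.update x j ω ∈ A ↔ x ∈ A)
    (hB : ∀ x, μ {ω | Function.update x j ω ∈ B} ≤ c) :
    Measure.pi (fun _ : ι => μ) (A ∩ B) ≤ c * Measure.pi (fun _ : ι => μ) A := by
  have hm : ∀ s : Set (ι → Ω), MeasurableSet s := fun s => s.toFinite.measurableSet
  rw [← lintegral_indicator_one (hm _), ← lintegral_indicator_one (hm A),
    ← lintegral_const_mul _ (measurable_one.indicator (hm A))]
  refine lintegral_le_of_lmarginal_le {j} (measurable_one.indicator (hm _))
    ((measurable_one.indicator (hm A)).const_mul c) ?_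
  rw [lmarginal_singleton, lmarginal_singleton]
  intro x
  by_cases hx : x ∈ A
  · have h1 : (fun ω => (A ∩ B).indicator (1 : (ι → Ω) → ℝ≥0∞) (Function.update x j ω)) =
        {ω | Function.update x j ω ∈ B}.indicator 1 := by
      ext ω
      by_cases hb : Function.update x j ω ∈ B <;> simp [hA, hx, hb]
    have h2 : (fun ω => c * A.indicator (1 : (ι → Ω) → ℝ≥0∞) (Function.update x j ω)) =
        fun _ => c := by
      ext ω
      simp [hA, hx]
    simp only [h1, h2]
    rw [lintegral_indicator_one (Set.toFinite _).measurableSet]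
    simpa using hB x
  · have h1 : (fun ω => (A ∩ B).indicator (1 : (ι → Ω) → ℝ≥0∞) (Function.update x j ω)) =
        fun _ => 0 := by
      ext ω
      simp [hA, hx]
    simp only [h1]
    simp

/-- Remove the last clause added. Given the others, it must hit a fixed set of at most `K`
variables, which has probability at most `K * K / n`. -/
theorem pi_parentEvent_le (h : K ≤ n) (hK : 1 ≤ K) {π : Fin m → Fin m} (v : Fin n)
    {J : Finset (Fin m)} (hπ : IsParentMap π J) :
    Measure.pi (fun _ : Fin m => clauseLaw n K) (parentEvent K π v J) ≤
      ((K * K : ℕ) / (n : ℝ≥0∞)) ^ J.card := by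
  have := isProbabilityMeasure_clauseLaw h
  have : MeasurableSingletonClass (Fin K ↪ Fin n) := ⟨fun _ => trivial⟩
  induction hπ with
  | empty => simpa using prob_le_one
  | @grow J j hJ hjJ hj ih =>
    let B : Set (NAEFormula n K m) := {Φ | if π j = j then v ∈ clauseVars Φ j else
      ∃ x ∈ clauseVars Φ j, x ∈ clauseVars Φ (π j)}
    have hsub : parentEvent K π v (insert j J) ⊆ parentEvent K π v J ∩ B := fun Φ hΦ =>
      ⟨fun i hi => hΦ i (Finset.mem_insert_of_mem hi), hΦ j (Finset.mem_insert_self _ _)⟩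
    have hup : ∀ (Φ : NAEFormula n K m) (ω : NAEClause n K), ∀ i, i ≠ j →
        clauseVars (Function.update Φ j ω) i = clauseVars Φ i := by
      intro Φ ω i hi
      simp [clauseVars, Function.update_of_ne hi]
    rw [Finset.card_insert_of_notMem hjJ, pow_succ']
    refine (measure_mono hsub).trans ((pi_le_mul_of_fiber_le (clauseLaw n K) j _ B
      ((K * K : ℕ) / (n : ℝ≥0∞)) ?_ ?_).trans (by gcongr))
    · intro Φ ω
      have hne : ∀ i ∈ J, i ≠ j := by rintro i hi rfl; exact hjJ hi
      refine forall₂_congr fun i hi => ?_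
      rw [hup _ _ i (hne i hi), hup _ _ (π i) (hne _ (hJ.mem i hi))]
    · intro Φ
      have key : ∃ S : Finset (Fin n), S.card ≤ K ∧ ∀ ω, Function.update Φ j ω ∈ B →
          ∃ x ∈ Set.range ω.1, x ∈ S := by
        by_cases hjj : π j = j
        · refine ⟨{v}, by simpa using hK, fun ω hω => ⟨v, ?_, by simp⟩⟩
          simp only [B, Set.mem_ofPred_eq, if_pos hjj, mem_clauseVars, Function.update_self] at hω
          exact hω
        · refine ⟨clauseVars Φ (π j), (card_clauseVars _ _).le, fun ω hω => ?_⟩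
          simp only [B, Set.mem_ofPred_eq, if_neg hjj, hup _ _ _ hjj] at hω
          obtain ⟨x, hx, hx'⟩ := hω
          rw [mem_clauseVars, Function.update_self] at hx
          exact ⟨x, hx, hx'⟩
      obtain ⟨S, hS, hSB⟩ := key
      refine (measure_mono fun ω hω => hSB ω hω).trans ((clauseLaw_hits_le S).trans ?_)
      gcongr

theorem isProbabilityMeasure_labelLaw (n : ℕ) : IsProbabilityMeasure (labelLaw n) := by
  have h3 : IsProbabilityMeasure ((volume : Measure ℝ).restrict (Set.Icc 0 1)) := ⟨by simp⟩
  unfold labelLaw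
  infer_instance

theorem labelLaw_level_eq_le {M : ℕ} (hM : 0 < M) (S : Finset (Fin n)) (a : ℕ) :
    labelLaw n {z | ∀ x ∈ S, level M z x = a} ≤ ENNReal.ofReal (1 / M) ^ S.card := by
  have h3 : IsProbabilityMeasure ((volume : Measure ℝ).restrict (Set.Icc 0 1)) := ⟨by simp⟩
  have hM' : (0 : ℝ) < M := by exact_mod_cast hM
  have hset : {z : Fin n → ℝ | ∀ x ∈ S, level M z x = a} = Set.univ.pi fun x =>
      if x ∈ S then {t : ℝ | min ⌊M * t⌋₊ M = a} else Set.univ := by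
    ext z
    simp only [Set.mem_ofPred_eq, Set.mem_univ_pi, level]
    refine forall_congr' fun x => ?_
    by_cases hx : x ∈ S <;> simp [hx]
  have hone : (volume : Measure ℝ).restrict (Set.Icc 0 1) {t : ℝ | min ⌊M * t⌋₊ M = a} ≤
      ENNReal.ofReal (1 / M) := by
    rw [Measure.restrict_apply' measurableSet_Icc]
    have hsub : {t : ℝ | min ⌊M * t⌋₊ M = a} ∩ Set.Icc 0 1 ⊆
        Set.Icc ((a : ℝ) / M) ((a + 1) / M) := by
      rintro t ⟨ht, h0, h1⟩
      have hle : M * t ≤ (M : ℝ) := by nlinarith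
      -- The cap is inactive on `[0, 1]`. Level `M` occurs there only at `t = 1`, so the bound `1 /
      -- M` covers it too.
      have hfl : ⌊M * t⌋₊ ≤ M := Nat.floor_le_of_le hle
      rw [Set.mem_ofPred_eq, min_eq_left hfl] at ht
      have h2 := Nat.floor_le (mul_nonneg hM'.le h0)
      have h3 := Nat.lt_floor_add_one ((M : ℝ) * t)
      rw [ht] at h2 h3
      rw [Set.mem_Icc, div_le_iff₀ hM', le_div_iff₀ hM']
      constructor <;> linarith
    refine (measure_mono hsub).trans ?_
    rw [Real.volume_Icc]
    refine ENNReal.ofReal_le_ofReal (le_of_eq ?_)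
    field_simp
    ring
  rw [hset, labelLaw, Measure.pi_pi]
  calc _ ≤ ∏ x, if x ∈ S then ENNReal.ofReal (1 / M) else 1 := by
        refine Finset.prod_le_prod' fun x _ => ?_
        by_cases hx : x ∈ S
        · simpa [hx] using hone
        · simp only [hx, if_false]
          exact prob_le_one
    _ = _ := by simp

theorem pi_parentEvent_le_ofReal (h : K ≤ n) (hK : 1 ≤ K) {π : Fin m → Fin m} (v : Fin n)
    {J : Finset (Fin m)} (hπ : IsParentMap π J) :
    Measure.pi (fun _ : Fin m => clauseLaw n K) (parentEvent K π v J) ≤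
      ENNReal.ofReal (((K : ℝ) * K / n) ^ J.card) := by
  refine (pi_parentEvent_le h hK v hπ).trans (le_of_eq ?_)
  have hn : (0 : ℝ) < n := by exact_mod_cast v.pos
  rw [ENNReal.ofReal_pow (by positivity), ENNReal.ofReal_div_of_pos hn, ← Nat.cast_mul,
    ENNReal.ofReal_natCast, ENNReal.ofReal_natCast]

/-! ### Union bounds over clause sets, vertices and levels -/

theorem measure_biUnion_finset_le_card_mul {α ι : Type*} [MeasurableSpace α] (μ : Measure α)
    (I : Finset ι) (T : ι → Set α) (c : ℝ) (hc : ∀ i ∈ I, μ (T i) ≤ ENNReal.ofReal c) :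
    μ (⋃ i ∈ I, T i) ≤ ENNReal.ofReal (I.card * c) := by
  refine (measure_biUnion_finset_le _ _).trans ((Finset.sum_le_sum hc).trans (le_of_eq ?_))
  rw [Finset.sum_const, nsmul_eq_mul, ENNReal.ofReal_mul (Nat.cast_nonneg _),
    ENNReal.ofReal_natCast]

/-- The law of a formula with `m` clauses and of independent uniform labels. -/
noncomputable abbrev formulaLabelLaw (n K m : ℕ) : Measure (NAEFormula n K m × (Fin n → ℝ)) :=
  (Measure.pi fun _ : Fin m => clauseLaw n K).prod (labelLaw n)

theorem measure_many_clauses_le (h : K ≤ n) (hK : 1 ≤ K) (v : Fin n) (s : ℕ) :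
    formulaLabelLaw n K m
        {ω | s ≤ (Finset.univ.filter fun j => v ∈ clauseVars ω.1 j).card} ≤
      ENNReal.ofReal (m.choose s * ((K : ℝ) * K / n) ^ s) := by
  have := isProbabilityMeasure_clauseLaw h
  have := isProbabilityMeasure_labelLaw n
  have hsub : {ω : NAEFormula n K m × (Fin n → ℝ) |
      s ≤ (Finset.univ.filter fun j => v ∈ clauseVars ω.1 j).card} ⊆
      -- For `π = id` the parent event says that every clause of `J` contains `v`.
      ⋃ J ∈ Finset.powersetCard s Finset.univ, parentEvent K id v J ×ˢ Set.univ := by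
    intro ω hω
    obtain ⟨J, hJ, hJs⟩ := Finset.exists_subset_card_eq hω
    simp only [Set.mem_iUnion]
    refine ⟨J, Finset.mem_powersetCard.2 ⟨Finset.subset_univ _, hJs⟩, fun j hj => ?_, trivial⟩
    simpa using hJ hj
  refine (measure_mono hsub).trans ((measure_biUnion_finset_le_card_mul _ _ _
    (((K : ℝ) * K / n) ^ s) fun J hJ => ?_).trans (le_of_eq ?_))
  · refine (Measure.prod_prod_le _ _).trans ?_
    rw [measure_univ, mul_one]
    exact (pi_parentEvent_le_ofReal h hK v (isParentMap_id J)).trans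
      (by rw [(Finset.mem_powersetCard.1 hJ).2])
  · simp

/-- The factors count the parent maps, bound the parent event, count the subsets of at most `K *
J.card + 1` touched variables, and bound the probability that `k` labels share a slice. For a fixed
formula the last two concern only the independent labels. -/
theorem measure_attached_le (h : K ≤ n) (hK : 1 ≤ K) {M : ℕ} (hM : 0 < M) (v : Fin n)
    (J : Finset (Fin m)) (k a : ℕ) :
    formulaLabelLaw n K m
        {ω | Attached ω.1 v J ∧ ∃ S ⊆ touched ω.1 v J, S.card = k ∧ ∀ x ∈ S, level M ω.2 x = a} ≤
      ENNReal.ofReal ((J.card : ℝ) ^ J.card *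
        (((K : ℝ) * K / n) ^ J.card * (2 ^ (K * J.card + 1) * (1 / M) ^ k))) := by
  classical
  have := isProbabilityMeasure_clauseLaw h
  have := isProbabilityMeasure_labelLaw n
  have : MeasurableSingletonClass (Fin K ↪ Fin n) := ⟨fun _ => trivial⟩
  set t := J.card with ht
  let P : Finset (Fin m → Fin m) := Fintype.piFinset fun j => if j ∈ J then J else {j}
  have hP : P.card = t ^ t := by
    simp [P, Fintype.card_piFinset, apply_ite Finset.card, ht]
  let T : (Fin m → Fin m) → Set (NAEFormula n K m × (Fin n → ℝ)) := fun π =>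
    {ω | IsParentMap π J ∧ ω.1 ∈ parentEvent K π v J ∧
      ∃ S ⊆ touched ω.1 v J, S.card = k ∧ ∀ x ∈ S, level M ω.2 x = a}
  refine (measure_mono (t := ⋃ π ∈ P, T π) ?_).trans
    ((measure_biUnion_finset_le_card_mul _ _ _ (((K : ℝ) * K / n) ^ t *
      (2 ^ (K * t + 1) * (1 / M) ^ k)) fun π _ => ?_).trans (le_of_eq ?_))
  · rintro ω ⟨hω, hS⟩
    obtain ⟨π, h1, h2, h3⟩ := hω.exists_parentMap
    simp only [Set.mem_iUnion]
    refine ⟨π, Fintype.mem_piFinset.2 fun j => ?_, h1, h3, hS⟩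
    by_cases hj : j ∈ J
    · simpa [hj] using h1.mem j hj
    · simpa [hj] using h2 j hj
  · by_cases hπ : IsParentMap π J
    · rw [ENNReal.ofReal_mul (by positivity)]
      refine (prod_le_mul_of_section_le _ _ (parentEvent K π v J) (T π) (ENNReal.ofReal
        (2 ^ (K * t + 1) * (1 / M) ^ k)) (fun ω hω => hω.2.1) fun Φ _ => ?_).trans ?_
      · refine (measure_mono (t := ⋃ S ∈ Finset.powersetCard k (touched Φ v J),
          {z | ∀ x ∈ S, level M z x = a}) ?_).trans
          ((measure_biUnion_finset_le_card_mul _ _ _ ((1 / M) ^ k) fun S hS => ?_).trans ?_)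
        · rintro z ⟨_, _, S, hS, hSk, hz⟩
          simp only [Set.mem_iUnion]
          exact ⟨S, Finset.mem_powersetCard.2 ⟨hS, hSk⟩, hz⟩
        · rw [ENNReal.ofReal_pow (by positivity), ← (Finset.mem_powersetCard.1 hS).2]
          exact labelLaw_level_eq_le hM S a
        · refine ENNReal.ofReal_le_ofReal ?_
          gcongr
          rw [Finset.card_powersetCard]
          have h1 : (touched Φ v J).card.choose k ≤ 2 ^ (K * t + 1) :=
            (Nat.choose_le_two_pow _ _).trans
              (Nat.pow_le_pow_right (by norm_num) (card_touched_le Φ v J))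
          exact_mod_cast h1
      · gcongr
        exact pi_parentEvent_le_ofReal h hK v hπ
    · have : T π = ∅ := by
        ext ω
        simp [T, hπ]
      rw [this, measure_empty]
      exact zero_le
  · rw [hP]; push_cast; rfl

theorem choose_mul_le {d : ℝ} (hn : 0 < n) (hm : (m : ℝ) ≤ d * n) (t : ℕ) :
    (m.choose t : ℝ) * ((K : ℝ) * K / n) ^ t ≤ (d * (K * K)) ^ t / t.factorial := by
  have hn' : (0 : ℝ) < n := by exact_mod_cast hn
  calc (m.choose t : ℝ) * ((K : ℝ) * K / n) ^ t
      ≤ ((d * n) ^ t / t.factorial) * ((K : ℝ) * K / n) ^ t := by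
        gcongr
        refine (Nat.choose_le_pow_div t m).trans ?_
        gcongr
    _ = ((d * n) * ((K : ℝ) * K / n)) ^ t / t.factorial := by rw [mul_pow]; ring
    _ = _ := by
        congr 2
        field_simp

open Relation in
theorem measure_large_cluster_le (h : K ≤ n) (hK : 1 ≤ K) {d : ℝ} (hd : 0 < d)
    (hm : (m : ℝ) ≤ d * n) {M : ℕ} (hM : 0 < M) (v : Fin n) (r s a : ℕ) (hs : 0 < s) (C : ℝ)
    (hC1 : 1 ≤ C) (hC : Real.exp 1 * (d * (K * K)) * 2 ^ K ≤ C) :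
    formulaLabelLaw n K m {ω | level M ω.2 v = a ∧ s ≤ {w | ReflTransGen (fun x y =>
        ConnectedWithin (varGraph ω.1) r x y ∧ level M ω.2 x = level M ω.2 v ∧
          level M ω.2 y = level M ω.2 v) v w}.ncard} ≤
      ENNReal.ofReal ((r * s + 1) * (2 * (C ^ r / M) ^ s)) := by
  have hM' : (0 : ℝ) < M := by exact_mod_cast hM
  let T : Finset (Fin m) → Set (NAEFormula n K m × (Fin n → ℝ)) := fun J =>
    {ω | Attached ω.1 v J ∧ ∃ S ⊆ touched ω.1 v J, S.card = s ∧ ∀ x ∈ S, level M ω.2 x = a}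
  refine (measure_mono (t := ⋃ t ∈ Finset.range (r * s + 1),
    ⋃ J ∈ Finset.powersetCard t Finset.univ, T J) ?_).trans
    ((measure_biUnion_finset_le_card_mul _ _ _ (2 * (C ^ r / M) ^ s) fun t ht => ?_).trans
      (le_of_eq ?_))
  · rintro ω ⟨ha, hω⟩
    obtain ⟨k, rfl⟩ : ∃ k, s = k + 1 := ⟨s - 1, by omega⟩
    obtain ⟨S, J, h1, -, h3, h4, h5, h6⟩ :=
      exists_attached_of_le_ncard (fun x y hxy => hxy.1) k hω
    simp only [Set.mem_iUnion]
    refine ⟨J.card, Finset.mem_range.2 ?_, J,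
      Finset.mem_powersetCard.2 ⟨Finset.subset_univ _, rfl⟩, h4, S, h6, h1, fun x hx => ?_⟩
    · rw [Nat.mul_succ]; omega
    · rcases ReflTransGen.cases_tail (h3 x hx) with h | ⟨_, _, h⟩
      · rw [h, ha]
      · rw [h.2.2, ha]
  · have hn : 0 < n := v.pos
    refine (measure_biUnion_finset_le_card_mul _ _ _ ((t : ℝ) ^ t *
      (((K : ℝ) * K / n) ^ t * (2 ^ (K * t + 1) * (1 / M) ^ s))) fun J hJ => ?_).trans
      (ENNReal.ofReal_le_ofReal ?_)
    · rw [← (Finset.mem_powersetCard.1 hJ).2]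
      exact measure_attached_le h hK hM v J s a
    · rw [Finset.card_powersetCard, Finset.card_univ, Fintype.card_fin]
      -- The factorial from choosing `J` cancels the `t ^ t` parent maps up to an exponential
      -- factor.
      have hexp : (t : ℝ) ^ t / t.factorial ≤ Real.exp 1 ^ t := by
        rw [← Real.exp_nat_mul, mul_one]
        exact Real.pow_div_factorial_le_exp (t : ℝ) (Nat.cast_nonneg t) t
      calc (m.choose t : ℝ) * ((t : ℝ) ^ t *
            (((K : ℝ) * K / n) ^ t * (2 ^ (K * t + 1) * (1 / M) ^ s)))
          = (m.choose t * ((K : ℝ) * K / n) ^ t) *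
              ((t : ℝ) ^ t * (2 ^ (K * t + 1) * (1 / M) ^ s)) := by ring
        _ ≤ ((d * (K * K)) ^ t / t.factorial) *
              ((t : ℝ) ^ t * (2 ^ (K * t + 1) * (1 / M) ^ s)) := by
            gcongr
            exact choose_mul_le hn hm t
        _ = ((t : ℝ) ^ t / t.factorial) *
              ((d * (K * K)) ^ t * (2 ^ (K * t + 1) * (1 / M) ^ s)) := by ring
        _ ≤ Real.exp 1 ^ t * ((d * (K * K)) ^ t * (2 ^ (K * t + 1) * (1 / M) ^ s)) := by
            gcongr
        _ = (Real.exp 1 * (d * (K * K)) * 2 ^ K) ^ t * (2 * (1 / M) ^ s) := by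
            rw [mul_pow, mul_pow, pow_succ, pow_mul]; ring
        _ ≤ C ^ t * (2 * (1 / M) ^ s) := by gcongr
        -- `1 ≤ C` and `t ≤ r * s` make this bound uniform in `t`; summing over `t` then costs only
        -- `r * s + 1`.
        _ ≤ C ^ (r * s) * (2 * (1 / M) ^ s) := by
            gcongr
            exact Nat.lt_succ_iff.1 (Finset.mem_range.1 ht)
        _ = 2 * (C ^ r / M) ^ s := by rw [div_pow, div_pow, one_pow, pow_mul]; ring
  · simp

/-- Apart from an event of small probability all the influence ranges are small. -/
theorem measure_maxInfluence_gt_le (h : K ≤ n) (hK : 1 ≤ K) {d : ℝ} (hd : 0 < d) (r s M : ℕ)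
    (hs : 0 < s) (hM : 0 < M) (C : ℝ) (hC1 : 1 ≤ C)
    (hC : Real.exp 1 * (d * (K * K)) * 2 ^ K ≤ C) :
    jointLaw n K d {ω | (s * ((s * K + 1) ^ r + 1)) ^ (M + 1) < maxInfluence ω.1 ω.2 r} ≤
      ENNReal.ofReal (n * ((d * (K * K)) ^ s / s.factorial)) +
      ENNReal.ofReal (n * ((M + 1) * ((r * s + 1) * (2 * (C ^ r / M) ^ s)))) := by
  have hm : (⌊d * n⌋₊ : ℝ) ≤ d * n := Nat.floor_le (by positivity)
  let D : Fin n → Set (NAEFormula n K ⌊d * n⌋₊ × (Fin n → ℝ)) := fun v =>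
    {ω | s ≤ (Finset.univ.filter fun j => v ∈ clauseVars ω.1 j).card}
  let E : ℕ → Fin n → Set (NAEFormula n K ⌊d * n⌋₊ × (Fin n → ℝ)) := fun a v =>
    {ω | level M ω.2 v = a ∧ s ≤ {w | Relation.ReflTransGen (fun x y =>
        ConnectedWithin (varGraph ω.1) r x y ∧ level M ω.2 x = level M ω.2 v ∧
          level M ω.2 y = level M ω.2 v) v w}.ncard}
  have hsub : {ω : NAEFormula n K ⌊d * n⌋₊ × (Fin n → ℝ) |
      (s * ((s * K + 1) ^ r + 1)) ^ (M + 1) < maxInfluence ω.1 ω.2 r} ⊆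
      (⋃ v ∈ Finset.univ, D v) ∪ ⋃ v ∈ Finset.univ, ⋃ a ∈ Finset.range (M + 1), E a v := by
    intro ω hω
    by_contra hcon
    simp only [Set.mem_union, Set.mem_iUnion, not_or, not_exists] at hcon
    refine absurd hω (not_lt.2 (maxInfluence_le ω.1 ω.2 r M s (fun v => ?_) fun v => ?_))
    · exact (not_le.1 fun hle => hcon.1 v (Finset.mem_univ v) hle).le
    · refine (not_le.1 fun hle => hcon.2 v (Finset.mem_univ v) (level M ω.2 v)
        (Finset.mem_range.2 (Nat.lt_succ_iff.2 (min_le_right _ _))) ⟨rfl, hle⟩).le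
  refine (measure_mono hsub).trans ((measure_union_le _ _).trans (add_le_add ?_ ?_))
  · refine (measure_biUnion_finset_le_card_mul _ _ _ ((d * (K * K)) ^ s / s.factorial)
      fun v _ => ?_).trans (le_of_eq (by simp))
    exact (measure_many_clauses_le h hK v s).trans
      (ENNReal.ofReal_le_ofReal (choose_mul_le v.pos hm s))
  · refine (measure_biUnion_finset_le_card_mul _ _ _
      ((M + 1) * ((r * s + 1) * (2 * (C ^ r / M) ^ s))) fun v _ => ?_).trans
      (le_of_eq (by simp))
    exact (measure_biUnion_finset_le_card_mul _ _ _ _ fun a _ =>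
      measure_large_cluster_le h hK hd hm hM v r s a hs C hC1 hC).trans (le_of_eq (by simp))

end Formula

/-! ### Asymptotics and choice of parameters -/

theorem tendsto_add_one_pow_mul_half_pow (q : ℕ) :
    Tendsto (fun s : ℕ => ((s : ℝ) + 1) ^ q * (1 / 2) ^ s) atTop (𝓝 0) := by
  have h := ((tendsto_pow_const_mul_const_pow_of_abs_lt_one q
    (r := (1 / 2 : ℝ)) (by norm_num [abs_lt])).comp (tendsto_add_atTop_nat 1)).const_mul 2
  rw [mul_zero] at h
  refine h.congr fun s => ?_
  simp only [Function.comp_apply, Nat.cast_add, Nat.cast_one, pow_succ _ s]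
  ring

theorem tendsto_add_one_pow_mul_pow_div_factorial (q : ℕ) (x : ℝ) :
    Tendsto (fun s : ℕ => ((s : ℝ) + 1) ^ q * (x ^ s / s.factorial)) atTop (𝓝 0) := by
  -- Writes `x ^ s` as `(1 / 2) ^ s * (2 * x) ^ s`: one factor absorbs the polynomial, the other the
  -- factorial.
  have h := (tendsto_add_one_pow_mul_half_pow q).mul
    (FloorSemiring.tendsto_pow_div_factorial_atTop (2 * x))
  rw [mul_zero] at h
  refine h.congr fun s => ?_
  rw [mul_pow, one_div, inv_pow]
  field_simp

theorem influence_bound_le {K r M s : ℕ} (hs : 1 ≤ s) :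
    (s * ((s * K + 1) ^ r + 1)) ^ (M + 1) ≤
      ((K + 1) ^ r + 1) ^ (M + 1) * s ^ ((r + 1) * (M + 1)) := by
  rw [pow_mul, ← mul_pow]
  refine Nat.pow_le_pow_left ?_ _
  calc s * ((s * K + 1) ^ r + 1) ≤ s * ((s * (K + 1)) ^ r + s ^ r) := by
        gcongr
        · rw [mul_add]; omega
        · exact Nat.one_le_pow _ _ hs
    _ = ((K + 1) ^ r + 1) * s ^ (r + 1) := by rw [mul_pow, pow_succ]; ring

theorem mainTheorem7 (K : ℕ) (hK : 1 ≤ K) (d : ℝ) (hd : 0 < d) (r : ℕ) (hr : 0 < r) :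
    Tendsto
      (fun n : ℕ => jointLaw n K d
        {ω | (maxInfluence ω.1 ω.2 r : ℝ) ≥ (n : ℝ) ^ ((1 : ℝ) / 3)})
      atTop (𝓝 0) := by
  obtain ⟨C, hC1, hC⟩ : ∃ C : ℝ, 1 ≤ C ∧ Real.exp 1 * (d * (K * K)) * 2 ^ K ≤ C :=
    ⟨max 1 _, le_max_left _ _, le_max_right _ _⟩
  obtain ⟨M, hCM⟩ := exists_nat_ge (2 * C ^ r)
  have hCr : 1 ≤ C ^ r := one_le_pow₀ hC1
  have hM' : (0 : ℝ) < M := by linarith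
  have hM : 0 < M := by exact_mod_cast hM'
  have hhalf : C ^ r / M ≤ 1 / 2 := by rw [div_le_div_iff₀ hM' two_pos]; linarith
  set c := (r + 1) * (M + 1) with hc
  set D := ((K + 1) ^ r + 1) ^ (M + 1) with hD
  -- The influence bound is `D * s ^ c`. One spare power of `s` beats `D`, and the 3 matches the
  -- cube root.
  set q := 3 * (c + 1) with hq
  have hq0 : q ≠ 0 := by omega
  have hqr : (0 : ℝ) < q := by exact_mod_cast Nat.pos_of_ne_zero hq0
  let s : ℕ → ℕ := fun n => ⌊(n : ℝ) ^ (1 / (q : ℝ))⌋₊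
  have hs : Tendsto s atTop atTop := tendsto_nat_floor_atTop.comp
    ((tendsto_rpow_atTop (by positivity)).comp tendsto_natCast_atTop_atTop)
  have hroot : ∀ n : ℕ, ((n : ℝ) ^ (1 / (q : ℝ))) ^ q = n := fun n => by
    rw [one_div]; exact Real.rpow_inv_natCast_pow (Nat.cast_nonneg n) hq0
  have hsle : ∀ n : ℕ, (s n : ℝ) ^ q ≤ n := fun n => by
    conv_rhs => rw [← hroot n]
    exact pow_le_pow_left₀ (Nat.cast_nonneg _) (Nat.floor_le (by positivity)) q
  have hlt : ∀ n : ℕ, (n : ℝ) ≤ ((s n : ℝ) + 1) ^ q := fun n => by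
    conv_lhs => rw [← hroot n]
    exact pow_le_pow_left₀ (by positivity) (Nat.lt_floor_add_one _).le q
  -- The error bound in terms of `s` alone, with `n` replaced by the upper bound `(s + 1) ^ q`.
  let g : ℕ → ℝ≥0∞ := fun t =>
    ENNReal.ofReal (((t : ℝ) + 1) ^ q * ((d * (K * K)) ^ t / t.factorial)) +
    ENNReal.ofReal (2 * (M + 1) * (r + 1) * (((t : ℝ) + 1) ^ (q + 1) * (1 / 2) ^ t))
  have hg : Tendsto g atTop (𝓝 0) := by
    have h1 := ENNReal.tendsto_ofReal
      (tendsto_add_one_pow_mul_pow_div_factorial q (d * (K * K)))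
    have h2 := ENNReal.tendsto_ofReal
      ((tendsto_add_one_pow_mul_half_pow (q + 1)).const_mul (2 * (M + 1) * (r + 1) : ℝ))
    have h := h1.add h2
    simp only [mul_zero, ENNReal.ofReal_zero, add_zero] at h
    exact h
  refine tendsto_of_tendsto_of_tendsto_of_le_of_le' tendsto_const_nhds (hg.comp hs)
    (Eventually.of_forall fun _ => zero_le) ?_
  filter_upwards [eventually_ge_atTop K, hs.eventually_gt_atTop D] with n hn hsD
  have hs0 : 0 < s n := by omega
  have hpow : (s n : ℝ) ^ (c + 1) ≤ (n : ℝ) ^ ((1 : ℝ) / 3) := by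
    rw [one_div]
    refine (Real.le_rpow_inv_iff_of_pos (by positivity) (Nat.cast_nonneg n) (by norm_num)).2 ?_
    have : ((s n : ℝ) ^ (c + 1)) ^ (3 : ℝ) = (s n : ℝ) ^ q := by
      rw [show (3 : ℝ) = ((3 : ℕ) : ℝ) by norm_num, Real.rpow_natCast, ← pow_mul, hq, mul_comm]
    rw [this]
    exact hsle n
  have hsub : {ω : NAEFormula n K ⌊d * n⌋₊ × (Fin n → ℝ) |
      (maxInfluence ω.1 ω.2 r : ℝ) ≥ (n : ℝ) ^ ((1 : ℝ) / 3)} ⊆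
      {ω | (s n * ((s n * K + 1) ^ r + 1)) ^ (M + 1) < maxInfluence ω.1 ω.2 r} := by
    intro ω hω
    have h1 : s n ^ (c + 1) ≤ maxInfluence ω.1 ω.2 r := by exact_mod_cast hpow.trans hω
    refine lt_of_le_of_lt (influence_bound_le hs0) (lt_of_lt_of_le ?_ h1)
    rw [← hc, ← hD, pow_succ' (s n)]
    exact Nat.mul_lt_mul_of_pos_right hsD (by positivity)
  refine (measure_mono hsub).trans
    ((measure_maxInfluence_gt_le hn hK hd r (s n) M hs0 hM C hC1 hC).trans (add_le_add ?_ ?_))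
  · refine ENNReal.ofReal_le_ofReal ?_
    gcongr
    exact hlt n
  · refine ENNReal.ofReal_le_ofReal ?_
    calc (n : ℝ) * ((M + 1) * ((r * s n + 1) * (2 * (C ^ r / M) ^ s n)))
        ≤ ((s n : ℝ) + 1) ^ q *
            ((M + 1) * (((r + 1) * (s n + 1)) * (2 * (1 / 2) ^ s n))) := by
          gcongr
          · exact hlt n
          · have : (0 : ℝ) ≤ r := Nat.cast_nonneg r
            have : (0 : ℝ) ≤ s n := Nat.cast_nonneg _
            nlinarith
      _ = _ := by ring
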